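/- \textbf{Theorem 3 (Advantage of the I/O kernel).} Let $p$ be a Borel probability measure on $\mathbb{R}^d$ (the input distribution), $n \ge 1$, $\sigma_n^2>0$, and let $\bar h_{\mathrm{NN}}:\mathbb{R}^d\to\mathbb{R}^m$ be continuous (for instance a neural network with continuous activations). For $\sigma,l>0$ let the RBF kernels be $k_{\mathrm{in}}(\mathbf{x},\mathbf{x}')=\sigma^2\exp\left(-\frac{1}{2l^2}\lVert \mathbf{x}-\mathbf{x}'\rVert^2\right)$ and $k_{\mathrm{out}}(\mathbf{x},\mathbf{x}')=\sigma^2\exp\left(-\frac{1}{2l^2}\lVert \bar h_{\mathrm{NN}}(\mathbf{x})-\bar h_{\mathrm{NN}}(\mathbf{x}')\rVert^2\right)$, each with its own hyperparameters $(\sigma,l)$; the I/O kernels are the sums $k_{\mathrm{in}}+k_{\mathrm{out}}$. Let $f_{\mathrm{in}}\sim\mathcal{GP}(0,k_{\mathrm{in}})$, $f_{\mathrm{out}}\sim\mathcal{GP}(0,k_{\mathrm{out}})$ for some fixed hyperparameters, let $\xi_1,\dots,\xi_n$ be i.i.d. $\mathcal{N}(0,\sigma_n^2)$, with $f_{\mathrm{in}}$,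 $f_{\mathrm{out}}$ and $(\xi_i)_i$ independent. Put $h=f_{\mathrm{in}}+f_{\mathrm{out}}$ and $y_i=h(\mathbf{x}_i)+\xi_i$. For a kernel $k$, a noise variance $\tau>0$ and training inputs $\mathcal{X}=(\mathbf{x}_1,\dots,\mathbf{x}_n)$, let $\bar h_{k,\tau}(\mathbf{x})=\mathbf{k}(\mathbf{x})^\top(K+\tau I)^{-1}\mathbf{y}$, with $K=(k(\mathbf{x}_i,\mathbf{x}_j))_{i,j}$ and $\mathbf{k}(\mathbf{x})=(k(\mathbf{x},\mathbf{x}_i))_i$, be the GP predictor, and let $E_{k,\tau}(\mathcal{X})=\mathbb{E}\left[(h(\mathbf{x})-\bar h_{k,\tau}(\mathbf{x}))^2\right]$, where the expectation is over $\mathbf{x}\sim p$ (independent of everything else), $h$ and the noise. Let $E^h_{\mathrm{I/O}}(\mathcal{X})$, $E^h_{\mathrm{I}}(\mathcal{X})$, $E^h_{\mathrm{O}}(\mathcal{X})$ be the infima of $E_{k,\tau}(\mathcal{X})$ over all noise variances $\tau>0$ and all positive hyperparameters of the I/O kernel, of the input kernel alone, and of the output kernel alone, respectively (the learners use optimal hyperparameters).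 Let $E^h_{\mathrm{I/O}}$, $E^h_{\mathrm{I}}$, $E^h_{\mathrm{O}}$ be their averages over $\mathbf{x}_1,\dots,\mathbf{x}_n$ drawn i.i.d. from $p$, independently of $h$ and the noise. Assume that $\bar h_{\mathrm{NN}}$ is nontrivially non-affine: for some measure $\nu$ on $(\mathbb{R}^d)^3$ for which $\nu$-almost every triple lies in $(\operatorname{supp} p)^3$, the set of triples $(\mathbf{x},\mathbf{x}',\mathbf{x}'')$ with $\lVert\mathbf{x}-\mathbf{x}'\rVert=\lVert\mathbf{x}-\mathbf{x}''\rVert$ but $\lVert\bar h_{\mathrm{NN}}(\mathbf{x})-\bar h_{\mathrm{NN}}(\mathbf{x}')\rVert\ne\lVert\bar h_{\mathrm{NN}}(\mathbf{x})-\bar h_{\mathrm{NN}}(\mathbf{x}'')\rVert$ has positive $\nu$-measure. Then $$E^h_{\mathrm{I/O}}<E^h_{\mathrm{I}}\qquad\text{and}\qquad E^h_{\mathrm{I/O}}<E^h_{\mathrm{O}}.$$ Moreover, for every choice of training inputs $\mathcal{X}$, $E^h_{\mathrm{I/O}}(\mathcal{X})$ is attained at the true hyperparameters and the true noise variance $\sigma_n^2$,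 and $E^h_{\mathrm{I/O}}(\mathcal{X})\le E^h_{\mathrm{I}}(\mathcal{X})$ and $E^h_{\mathrm{I/O}}(\mathcal{X})\le E^h_{\mathrm{O}}(\mathcal{X})$. -/

import Mathlib

open MeasureTheory ProbabilityTheory
open scoped ENNReal NNReal Matrix

namespace IOKernel

/-- Hyperparameters of a (non-trivial) RBF kernel: a positive signal variance `σ²` and a positive
length scale `l`. -/
structure RBFParams where
  signalVar : ℝ
  lengthScale : ℝ
  signalVar_pos : 0 < signalVar
  lengthScale_pos : 0 < lengthScale

/-- The RBF kernel `k(u, v) = σ² exp (- ‖u - v‖² / (2 l²))`. -/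
noncomputable def rbf {V : Type*} [NormedAddCommGroup V] (θ : RBFParams) (u v : V) : ℝ :=
  θ.signalVar * Real.exp (-(1 / (2 * θ.lengthScale ^ 2)) * ‖u - v‖ ^ 2)

/-- The input kernel, acting on the inputs themselves. -/
noncomputable def inKernel {d : ℕ} (θ : RBFParams) (x x' : EuclideanSpace ℝ (Fin d)) : ℝ :=
  rbf θ x x'

/-- The output kernel: an RBF kernel acting on the network outputs `hNN x`, `hNN x'`. -/
noncomputable def outKernel {d m : ℕ}
    (hNN : EuclideanSpace ℝ (Fin d) → EuclideanSpace ℝ (Fin m))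
    (θ : RBFParams) (x x' : EuclideanSpace ℝ (Fin d)) : ℝ :=
  rbf θ (hNN x) (hNN x')

/-- The I/O kernel: input kernel plus output kernel, each with its own hyperparameters. -/
noncomputable def ioKernel {d m : ℕ}
    (hNN : EuclideanSpace ℝ (Fin d) → EuclideanSpace ℝ (Fin m))
    (θ : RBFParams × RBFParams) (x x' : EuclideanSpace ℝ (Fin d)) : ℝ :=
  inKernel θ.1 x x' + outKernel hNN θ.2 x x'

/-- `f ∼ GP(0, k)`: a Gaussian process with mean zero and covariance function `k`. -/
structure IsCenteredGP {Ω T : Type*} [MeasurableSpace Ω] (f : T → Ω → ℝ) (k : T → T → ℝ)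
    (P : Measure Ω) : Prop where
  isGaussianProcess : IsGaussianProcess f P
  mean_zero : ∀ t, ∫ ω, f t ω ∂P = 0
  covariance_eq : ∀ s t, covariance (f s) (f t) P = k s t

/-- The data model: `fIn ∼ GP(0, k_in)`, `fOut ∼ GP(0, k_out)`, and observation noises
`ξ₁, …, ξₙ` that are i.i.d. `N(0, σₙ²)`; the two signals and the noise are independent. -/
structure IsIOModel {Ω : Type*} [MeasurableSpace Ω] (P : Measure Ω) {d m n : ℕ}
    (hNN : EuclideanSpace ℝ (Fin d) → EuclideanSpace ℝ (Fin m))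
    (θin θout : RBFParams) (noiseVar : ℝ≥0)
    (fIn fOut : EuclideanSpace ℝ (Fin d) → Ω → ℝ) (ξ : Fin n → Ω → ℝ) : Prop where
  fIn_gp : IsCenteredGP fIn (inKernel θin) P
  fOut_gp : IsCenteredGP fOut (outKernel hNN θout) P
  noise_law : ∀ i, HasLaw (ξ i) (gaussianReal 0 noiseVar) P
  noise_indep : iIndepFun ξ P
  signals_indep : IndepFun (fun ω x => fIn x ω) (fun ω x => fOut x ω) P
  signals_noise_indep :
    IndepFun (fun ω => ((fun x => fIn x ω), (fun x => fOut x ω))) (fun ω i => ξ i ω) P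

/-- The set of triples `(x, x', x'')` with `‖x - x'‖ = ‖x - x''‖` whose images under `hNN` satisfy
`‖hNN x - hNN x'‖ ≠ ‖hNN x - hNN x''‖`. -/
def nonAffineTriples {d m : ℕ}
    (hNN : EuclideanSpace ℝ (Fin d) → EuclideanSpace ℝ (Fin m)) :
    Set (EuclideanSpace ℝ (Fin d) × EuclideanSpace ℝ (Fin d) × EuclideanSpace ℝ (Fin d)) :=
  {t | ‖t.1 - t.2.1‖ = ‖t.1 - t.2.2‖ ∧ ‖hNN t.1 - hNN t.2.1‖ ≠ ‖hNN t.1 - hNN t.2.2‖}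

/-- `hNN` is nontrivially non-affine, as measured by `ν`: the set of triples above has positive
measure. The measure `ν` on triples is a parameter, since the equidistant triples are a null set
for the product of three measures with a density; it may for instance be the product measure
`p ⊗ p ⊗ p` of an input distribution with atoms, or the surface measure on the
set of equidistant triples. -/
def NontriviallyNonAffine {d m : ℕ}
    (hNN : EuclideanSpace ℝ (Fin d) → EuclideanSpace ℝ (Fin m))
    (ν : Measure
      (EuclideanSpace ℝ (Fin d) × EuclideanSpace ℝ (Fin d) × EuclideanSpace ℝ (Fin d))) : Prop :=
  0 < ν (nonAffineTriples hNN)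

/-- The GP predictor (posterior mean) `k_*ᵀ (K + τ I)⁻¹ y` at the test point `x`, for kernel `k`,
noise variance `τ`, training inputs `X` and training targets `y`. -/
noncomputable def gpPredictor {T : Type*} {n : ℕ} (k : T → T → ℝ) (τ : ℝ)
    (X : Fin n → T) (y : Fin n → ℝ) (x : T) : ℝ :=
  (fun i => k x (X i)) ⬝ᵥ
    ((Matrix.of (fun i j => k (X i) (X j)) + τ • (1 : Matrix (Fin n) (Fin n) ℝ))⁻¹ *ᵥ y)

/-- The expected generalization error `𝔼[(h(x) - h̄(x))²]`, given the training inputs `X`, of the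
GP with kernel `k` and noise variance `τ` trained on `yᵢ = h(Xᵢ) + ξᵢ`; the expectation is over
the test input `x ∼ p`, the random target function `h` and the noise. -/
noncomputable def genError {Ω T : Type*} [MeasurableSpace Ω] [MeasurableSpace T] {n : ℕ}
    (P : Measure Ω) (p : Measure T) (h : T → Ω → ℝ) (ξ : Fin n → Ω → ℝ)
    (k : T → T → ℝ) (τ : ℝ) (X : Fin n → T) : ℝ≥0∞ :=
  ∫⁻ x, ∫⁻ ω,
    ENNReal.ofReal ((h x ω - gpPredictor k τ X (fun i => h (X i) ω + ξ i ω) x) ^ 2) ∂P ∂p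

/-- The expected generalization error, given the training inputs `X`, of the GP learner whose
kernel belongs to the parametrized family `k` and which uses optimal kernel hyperparameters `θ`
and an optimal noise variance `τ > 0` (both may depend on `X`). -/
noncomputable def optGenError {Ω T Θ : Type*} [MeasurableSpace Ω] [MeasurableSpace T] {n : ℕ}
    (P : Measure Ω) (p : Measure T) (h : T → Ω → ℝ) (ξ : Fin n → Ω → ℝ)
    (k : Θ → T → T → ℝ) (X : Fin n → T) : ℝ≥0∞ :=
  ⨅ (θ : Θ) (τ : Set.Ioi (0 : ℝ)), genError P p h ξ (k θ) τ X

/-- The expected generalization error of the GP learner with optimal hyperparameters, averaged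
over training inputs drawn i.i.d. from `p`. -/
noncomputable def expGenError {Ω T Θ : Type*} [MeasurableSpace Ω] [MeasurableSpace T] {n : ℕ}
    (P : Measure Ω) (p : Measure T) (h : T → Ω → ℝ) (ξ : Fin n → Ω → ℝ)
    (k : Θ → T → T → ℝ) : ℝ≥0∞ :=
  ∫⁻ X, optGenError P p h ξ k X ∂(Measure.pi fun _ : Fin n => p)

end IOKernel

/-! Every GP predictor is linear in the targets, so its mean squared error at a test point depends
only on first and second moments. It is a quadratic function of the weights with matrix `K + σₙ² I`,
where `K` is the true Gram matrix. The true I/O kernel with the true noise gives the minimizing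
weights at every test point, hence all the weak inequalities; any other weights cost at least `σₙ²`
times their squared distance from the minimizer (`meanSqError_gpWeights_add_le`).

Strictness after taking infima needs a loss that is uniform in the hyperparameters of the
single-kernel learner. A triple `(x₀, x₁, x₂)` of the hypothesis exists in the support. If all
training inputs equal `x₀`, the true weights at `z` are proportional to `k z x₀`, while an RBF
learner on features `φ` has weights `b exp (-a ‖φ z - φ x₀‖²)`. For `φ = id` these agree at `x₁` and
`x₂`, but `k` does not; for `φ = hNN`, log-convexity excludes a match at `x₀`, `x₁`, `x₂`
(`exp_sum_ne_exp`).

Coinciding inputs may form a null set, so the mismatch is spread to a neighbourhood by continuity,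
and made uniform by compactness for bounded `a` and by decay of the exponential for large `a`
(`exists_le_normalizedResidual`). Neighbourhoods of support points have positive measure, which
yields a gap first in the test input (`exists_genError_gap`), then in the training inputs
(`lintegral_pi_lt_of_gap`). -/

namespace IOKernel

/-! ### Positive semidefiniteness of the RBF kernel -/

section PosSemidef

variable {V : Type*} [NormedAddCommGroup V] [InnerProductSpace ℝ V] [FiniteDimensional ℝ V]

/-- The Gaussian function is the cosine transform of the standard Gaussian measure. -/
theorem integral_cos_inner_stdGaussian [MeasurableSpace V] [BorelSpace V] (t : V) :
    ∫ x, Real.cos (inner ℝ x t) ∂(stdGaussian V) = Real.exp (-‖t‖ ^ 2 / 2) := by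
  have h := congrArg Complex.re (charFun_stdGaussian (E := V) t)
  rw [charFun_apply] at h
  have hint : Integrable (fun x : V => Complex.exp (inner ℝ x t * Complex.I)) (stdGaussian V) := by
    refine Integrable.of_bound (C := 1) ?_ (Filter.Eventually.of_forall fun x => ?_)
    · exact Continuous.aestronglyMeasurable (by fun_prop)
    · rw [Complex.norm_exp_ofReal_mul_I]
  have h1 := integral_re hint
  simp only [RCLike.re_to_complex, Complex.exp_ofReal_mul_I_re] at h1
  rw [h1, h, show (-(‖t‖ : ℂ) ^ 2 / 2) = ((-‖t‖ ^ 2 / 2 : ℝ) : ℂ) by push_cast; ring,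
    Complex.exp_ofReal_re]

/-- Gram matrices of the RBF kernel are positive semidefinite. -/
theorem rbf_posSemidef (θ : RBFParams) {n : ℕ} (u : Fin n → V) :
    (Matrix.of fun i j => rbf θ (u i) (u j)).PosSemidef := by
  borelize V
  refine Matrix.PosSemidef.of_dotProduct_mulVec_nonneg ?_ fun v => ?_
  · ext i j
    simp [rbf, norm_sub_rev]
  · have hl := θ.lengthScale_pos
    set s : Fin n → V → ℝ := fun i x => inner ℝ x (θ.lengthScale⁻¹ • u i) with hs
    have hc : ∀ i, Continuous (s i) := fun i => by fun_prop
    have key : ∀ i j, rbf θ (u i) (u j) =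
        θ.signalVar * ∫ x, (Real.cos (s i x) * Real.cos (s j x) +
          Real.sin (s i x) * Real.sin (s j x)) ∂(stdGaussian V) := by
      intro i j
      have := integral_cos_inner_stdGaussian (θ.lengthScale⁻¹ • u i - θ.lengthScale⁻¹ • u j)
      simp_rw [inner_sub_right, Real.cos_sub] at this
      rw [this, rbf, ← smul_sub, norm_smul, Real.norm_eq_abs, mul_pow, sq_abs]
      congr 2
      field_simp
    have hint : ∀ i j, Integrable (fun x => v i * v j * (Real.cos (s i x) * Real.cos (s j x) +
          Real.sin (s i x) * Real.sin (s j x))) (stdGaussian V) := by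
      intro i j
      refine (Integrable.of_bound (C := 1) ?_ (Filter.Eventually.of_forall fun x => ?_)).const_mul _
      · exact Continuous.aestronglyMeasurable (by fun_prop)
      · rw [← Real.cos_sub, Real.norm_eq_abs]
        exact Real.abs_cos_le_one _
    -- The quadratic form is the mean of `|∑ i, v i * exp (I * s i x)|²`, written in real form.
    have hsum : star v ⬝ᵥ (Matrix.of fun i j => rbf θ (u i) (u j)) *ᵥ v =
        θ.signalVar * ∫ x, ((∑ i, v i * Real.cos (s i x)) ^ 2 +
          (∑ i, v i * Real.sin (s i x)) ^ 2) ∂(stdGaussian V) := by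
      have h1 : ∀ x, (∑ i, v i * Real.cos (s i x)) ^ 2 + (∑ i, v i * Real.sin (s i x)) ^ 2 =
          ∑ i, ∑ j, v i * v j * (Real.cos (s i x) * Real.cos (s j x) +
            Real.sin (s i x) * Real.sin (s j x)) := by
        intro x
        rw [sq, sq, Finset.sum_mul_sum, Finset.sum_mul_sum, ← Finset.sum_add_distrib]
        refine Finset.sum_congr rfl fun i _ => ?_
        rw [← Finset.sum_add_distrib]
        exact Finset.sum_congr rfl fun j _ => by ring
      simp_rw [h1]
      rw [integral_finsetSum _ fun i _ => integrable_finsetSum _ fun j _ => hint i j]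
      simp_rw [integral_finsetSum _ fun j _ => hint _ j, integral_const_mul]
      simp only [dotProduct, Matrix.mulVec, Matrix.of_apply, star_trivial, key, Finset.mul_sum]
      exact Finset.sum_congr rfl fun i _ => Finset.sum_congr rfl fun j _ => by ring
    rw [hsum]
    exact mul_nonneg θ.signalVar_pos.le (integral_nonneg fun x => by positivity)

end PosSemidef

/-! ### Optimal linear weights and the quadratic error -/

section Weights

variable {T : Type*} {n : ℕ}

/-- All Gram matrices of the kernel `k` are positive semidefinite. -/
def IsPosSemidefKernel (k : T → T → ℝ) : Prop :=
  ∀ (n : ℕ) (X : Fin n → T), (Matrix.of fun i j => k (X i) (X j)).PosSemidef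

/-- The regularized Gram matrix `K + τ I`. -/
def noisyGram (k : T → T → ℝ) (τ : ℝ) (X : Fin n → T) : Matrix (Fin n) (Fin n) ℝ :=
  Matrix.of (fun i j => k (X i) (X j)) + τ • (1 : Matrix (Fin n) (Fin n) ℝ)

/-- The weights that the GP predictor at `x` gives to the training targets. -/
noncomputable def gpWeights (k : T → T → ℝ) (τ : ℝ) (X : Fin n → T) (x : T) : Fin n → ℝ :=
  (noisyGram k τ X)⁻¹ *ᵥ fun i => k x (X i)

/-- The mean squared error of the linear predictor with weights `w` at `x`, when the target
function has covariance function `k` and the noise has variance `τ`. -/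
noncomputable def meanSqError (k : T → T → ℝ) (τ : ℝ) (X : Fin n → T) (x : T) (w : Fin n → ℝ) : ℝ :=
  k x x - 2 * (w ⬝ᵥ fun i => k x (X i)) + w ⬝ᵥ (noisyGram k τ X *ᵥ w)

variable {k : T → T → ℝ} {τ : ℝ}

theorem noisyGram_mulVec_apply (X : Fin n → T) (w : Fin n → ℝ) (i : Fin n) :
    (noisyGram k τ X *ᵥ w) i = ∑ j, k (X i) (X j) * w j + τ * w i := by
  rw [noisyGram, Matrix.add_mulVec, Matrix.smul_mulVec, Matrix.one_mulVec]
  rfl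

theorem noisyGram_posDef (hk : IsPosSemidefKernel k) (hτ : 0 < τ) (X : Fin n → T) :
    (noisyGram k τ X).PosDef :=
  Matrix.PosDef.posSemidef_add (hk n X) (Matrix.PosDef.one.smul hτ)

theorem det_noisyGram_ne_zero (hk : IsPosSemidefKernel k) (hτ : 0 < τ) (X : Fin n → T) :
    (noisyGram k τ X).det ≠ 0 :=
  (noisyGram_posDef hk hτ X).det_pos.ne'

theorem noisyGram_transpose (hk : IsPosSemidefKernel k) (hτ : 0 < τ) (X : Fin n → T) :
    (noisyGram k τ X)ᵀ = noisyGram k τ X := by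
  simpa [Matrix.IsHermitian] using (noisyGram_posDef hk hτ X).1

theorem noisyGram_mulVec_gpWeights (hk : IsPosSemidefKernel k) (hτ : 0 < τ) (X : Fin n → T)
    (x : T) : noisyGram k τ X *ᵥ gpWeights k τ X x = fun i => k x (X i) := by
  rw [gpWeights, Matrix.mulVec_mulVec,
    Matrix.mul_nonsing_inv _ (det_noisyGram_ne_zero hk hτ X).isUnit, Matrix.one_mulVec]

theorem eq_gpWeights (hk : IsPosSemidefKernel k) (hτ : 0 < τ) {X : Fin n → T} {x : T}
    {w : Fin n → ℝ} (hw : noisyGram k τ X *ᵥ w = fun i => k x (X i)) : gpWeights k τ X x = w := by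
  rw [gpWeights, ← hw, Matrix.mulVec_mulVec,
    Matrix.nonsing_inv_mul _ (det_noisyGram_ne_zero hk hτ X).isUnit, Matrix.one_mulVec]

theorem gpPredictor_eq_gpWeights (hk : IsPosSemidefKernel k) (hτ : 0 < τ) (X : Fin n → T)
    (y : Fin n → ℝ) (x : T) : gpPredictor k τ X y x = gpWeights k τ X x ⬝ᵥ y := by
  change (fun i => k x (X i)) ⬝ᵥ ((noisyGram k τ X)⁻¹ *ᵥ y) = _
  rw [Matrix.dotProduct_mulVec, ← Matrix.mulVec_transpose, Matrix.transpose_nonsing_inv,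
    noisyGram_transpose hk hτ, gpWeights]

theorem mul_dotProduct_self_le (hk : IsPosSemidefKernel k) (X : Fin n → T) (v : Fin n → ℝ) :
    τ * (v ⬝ᵥ v) ≤ v ⬝ᵥ (noisyGram k τ X *ᵥ v) := by
  have h := (hk n X).dotProduct_mulVec_nonneg v
  rw [star_trivial] at h
  rw [noisyGram, Matrix.add_mulVec, Matrix.smul_mulVec, Matrix.one_mulVec, dotProduct_add,
    dotProduct_smul, smul_eq_mul]
  linarith

/-- Completing the square: the GP weights minimize the mean squared error. -/
theorem meanSqError_eq_add (hk : IsPosSemidefKernel k) (hτ : 0 < τ) (X : Fin n → T) (x : T)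
    (w : Fin n → ℝ) :
    meanSqError k τ X x w = meanSqError k τ X x (gpWeights k τ X x) +
      (w - gpWeights k τ X x) ⬝ᵥ (noisyGram k τ X *ᵥ (w - gpWeights k τ X x)) := by
  have h1 := noisyGram_mulVec_gpWeights hk hτ X x
  set u := gpWeights k τ X x
  have h2 : u ⬝ᵥ (noisyGram k τ X *ᵥ w) = w ⬝ᵥ (noisyGram k τ X *ᵥ u) := by
    rw [Matrix.dotProduct_mulVec, ← Matrix.mulVec_transpose, noisyGram_transpose hk hτ,
      dotProduct_comm]
  rw [meanSqError, meanSqError, Matrix.mulVec_sub, sub_dotProduct, dotProduct_sub, dotProduct_sub,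
    h2, h1]
  ring

/-- The noise term makes the quadratic form strongly convex, so a discrepancy in the weights becomes
a quantitative excess error. -/
theorem meanSqError_gpWeights_add_le (hk : IsPosSemidefKernel k) (hτ : 0 < τ) (X : Fin n → T)
    (x : T) (w : Fin n → ℝ) :
    meanSqError k τ X x (gpWeights k τ X x) +
      τ * ((w - gpWeights k τ X x) ⬝ᵥ (w - gpWeights k τ X x)) ≤ meanSqError k τ X x w := by
  rw [meanSqError_eq_add hk hτ X x w]
  gcongr
  exact mul_dotProduct_self_le hk X _

theorem meanSqError_gpWeights_le (hk : IsPosSemidefKernel k) (hτ : 0 < τ) (X : Fin n → T)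
    (x : T) (w : Fin n → ℝ) :
    meanSqError k τ X x (gpWeights k τ X x) ≤ meanSqError k τ X x w := by
  refine le_trans ?_ (meanSqError_gpWeights_add_le hk hτ X x w)
  have : 0 ≤ (w - gpWeights k τ X x) ⬝ᵥ (w - gpWeights k τ X x) :=
    Finset.sum_nonneg fun i _ => mul_self_nonneg _
  nlinarith

/-- By the adjugate formula, with nonvanishing determinant. Joint continuity allows passing from
coinciding training inputs to nearby ones. -/
theorem continuous_gpWeights [TopologicalSpace T] (hk : IsPosSemidefKernel k) (hτ : 0 < τ)
    (hcont : Continuous fun q : T × T => k q.1 q.2) :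
    Continuous fun q : (Fin n → T) × T => gpWeights k τ q.1 q.2 := by
  have hcomp : ∀ {f g : (Fin n → T) × T → T}, Continuous f → Continuous g →
      Continuous fun q => k (f q) (g q) := fun hf hg => hcont.comp (hf.prodMk hg)
  have hA : Continuous fun q : (Fin n → T) × T => noisyGram k τ q.1 := by
    refine continuous_matrix fun i j => ?_
    simp only [noisyGram, Matrix.add_apply, Matrix.of_apply]
    exact (hcomp (by fun_prop) (by fun_prop)).add continuous_const
  unfold gpWeights
  simp_rw [Matrix.inv_def, Ring.inverse_eq_inv']
  refine Continuous.matrix_mulVec ((hA.matrix_det.inv₀ fun q =>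
    det_noisyGram_ne_zero hk hτ q.1).smul hA.matrix_adjugate) ?_
  exact continuous_pi fun i => hcomp (by fun_prop) (by fun_prop)

/-- If all training inputs coincide, then all training targets get the same weight. -/
theorem gpWeights_const (hk : IsPosSemidefKernel k) (hτ : 0 < τ) (x₀ x : T)
    (hne : n * k x₀ x₀ + τ ≠ 0) :
    gpWeights k τ (fun _ : Fin n => x₀) x = fun _ => k x x₀ / (n * k x₀ x₀ + τ) := by
  apply eq_gpWeights hk hτ
  ext i
  simp only [noisyGram_mulVec_apply, Finset.sum_const, Finset.card_univ, Fintype.card_fin,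
    nsmul_eq_mul]
  field_simp

end Weights

/-! ### Basic properties of the kernels -/

section Kernels

variable {d m : ℕ}

theorem isPosSemidefKernel_rbf_comp {T : Type*} (φ : T → EuclideanSpace ℝ (Fin m))
    (θ : RBFParams) : IsPosSemidefKernel fun x x' => rbf θ (φ x) (φ x') :=
  fun _ X => rbf_posSemidef θ fun i => φ (X i)

theorem isPosSemidefKernel_ioKernel (hNN : EuclideanSpace ℝ (Fin d) → EuclideanSpace ℝ (Fin m))
    (θ : RBFParams × RBFParams) : IsPosSemidefKernel (ioKernel hNN θ) :=
  fun n X => (isPosSemidefKernel_rbf_comp id θ.1 n X).add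
    (isPosSemidefKernel_rbf_comp hNN θ.2 n X)

theorem rbf_self {V : Type*} [NormedAddCommGroup V] (θ : RBFParams) (u : V) :
    rbf θ u u = θ.signalVar := by
  simp [rbf]

theorem rbf_pos {V : Type*} [NormedAddCommGroup V] (θ : RBFParams) (u v : V) : 0 < rbf θ u v :=
  mul_pos θ.signalVar_pos (Real.exp_pos _)

theorem ioKernel_pos (hNN : EuclideanSpace ℝ (Fin d) → EuclideanSpace ℝ (Fin m))
    (θ : RBFParams × RBFParams) (x x' : EuclideanSpace ℝ (Fin d)) : 0 < ioKernel hNN θ x x' :=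
  add_pos (rbf_pos _ _ _) (rbf_pos _ _ _)

theorem continuous_ioKernel {hNN : EuclideanSpace ℝ (Fin d) → EuclideanSpace ℝ (Fin m)}
    (hcont : Continuous hNN) (θ : RBFParams × RBFParams) :
    Continuous fun q : EuclideanSpace ℝ (Fin d) × EuclideanSpace ℝ (Fin d) =>
      ioKernel hNN θ q.1 q.2 := by
  unfold ioKernel inKernel outKernel rbf
  fun_prop

end Kernels

/-! ### Second moments of the data model -/

section Model

variable {Ω : Type*} [MeasurableSpace Ω] {P : Measure Ω} {d m n : ℕ}
  {hNN : EuclideanSpace ℝ (Fin d) → EuclideanSpace ℝ (Fin m)} {θin θout : RBFParams}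
  {noiseVar : ℝ≥0} {fIn fOut : EuclideanSpace ℝ (Fin d) → Ω → ℝ} {ξ : Fin n → Ω → ℝ}

theorem IsCenteredGP.memLp_two {T : Type*} {f : T → Ω → ℝ} {k : T → T → ℝ}
    (hf : IsCenteredGP f k P) (t : T) : MemLp (f t) 2 P :=
  (hf.isGaussianProcess.hasGaussianLaw_eval t).memLp_two

namespace IsIOModel

variable (hM : IsIOModel P hNN θin θout noiseVar fIn fOut ξ)
include hM

theorem memLp_target (x : EuclideanSpace ℝ (Fin d)) : MemLp ((fIn + fOut) x) 2 P :=
  (hM.fIn_gp.memLp_two x).add (hM.fOut_gp.memLp_two x)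

theorem memLp_noise (i : Fin n) : MemLp (ξ i) 2 P :=
  (hM.noise_law i).hasGaussianLaw.memLp_two

theorem integral_target [IsProbabilityMeasure P] (x : EuclideanSpace ℝ (Fin d)) : ∫ ω, (fIn + fOut) x ω ∂P = 0 := by
  have h := integral_add ((hM.fIn_gp.memLp_two x).integrable one_le_two)
    ((hM.fOut_gp.memLp_two x).integrable one_le_two)
  rw [hM.fIn_gp.mean_zero, hM.fOut_gp.mean_zero, add_zero] at h
  exact h

theorem integral_noise (i : Fin n) : ∫ ω, ξ i ω ∂P = 0 := by
  rw [(hM.noise_law i).integral_eq, integral_id_gaussianReal]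

theorem covariance_fIn_fOut (s t : EuclideanSpace ℝ (Fin d)) : cov[fIn s, fOut t; P] = 0 :=
  (hM.signals_indep.comp (measurable_pi_apply s) (measurable_pi_apply t)).covariance_eq_zero
    (hM.fIn_gp.memLp_two s) (hM.fOut_gp.memLp_two t)

theorem covariance_target [IsProbabilityMeasure P] (s t : EuclideanSpace ℝ (Fin d)) :
    cov[(fIn + fOut) s, (fIn + fOut) t; P] = ioKernel hNN (θin, θout) s t := by
  have hI := hM.fIn_gp.memLp_two
  have hO := hM.fOut_gp.memLp_two
  rw [Pi.add_apply, Pi.add_apply, covariance_add_left (hI s) (hO s) ((hI t).add (hO t)),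
    covariance_add_right (hI s) (hI t) (hO t), covariance_add_right (hO s) (hI t) (hO t),
    hM.covariance_fIn_fOut, covariance_comm (fOut s), hM.covariance_fIn_fOut,
    hM.fIn_gp.covariance_eq, hM.fOut_gp.covariance_eq, ioKernel]
  ring

theorem covariance_target_noise (s : EuclideanSpace ℝ (Fin d)) (i : Fin n) :
    cov[(fIn + fOut) s, ξ i; P] = 0 := by
  have hφ : Measurable fun q : (EuclideanSpace ℝ (Fin d) → ℝ) × (EuclideanSpace ℝ (Fin d) → ℝ) =>
      q.1 s + q.2 s := by fun_prop
  exact (hM.signals_noise_indep.comp hφ (measurable_pi_apply i)).covariance_eq_zero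
    (hM.memLp_target s) (hM.memLp_noise i)

theorem covariance_noise (i j : Fin n) :
    cov[ξ i, ξ j; P] = if i = j then (noiseVar : ℝ) else 0 := by
  split_ifs with h
  · rw [h, covariance_self (hM.noise_law j).aemeasurable, (hM.noise_law j).variance_eq,
      variance_id_gaussianReal]
  · exact (hM.noise_indep.indepFun h).covariance_eq_zero (hM.memLp_noise i) (hM.memLp_noise j)

theorem memLp_error (X : Fin n → EuclideanSpace ℝ (Fin d)) (x : EuclideanSpace ℝ (Fin d))
    (w : Fin n → ℝ) :
    MemLp (fun ω => (fIn + fOut) x ω - w ⬝ᵥ fun i => (fIn + fOut) (X i) ω + ξ i ω) 2 P :=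
  (hM.memLp_target x).sub (memLp_finsetSum _ fun i _ =>
    ((hM.memLp_target (X i)).add (hM.memLp_noise i)).const_mul (w i))

/-- The mean squared error of a linear predictor. -/
theorem integral_sq_error [IsProbabilityMeasure P] (X : Fin n → EuclideanSpace ℝ (Fin d))
    (x : EuclideanSpace ℝ (Fin d)) (w : Fin n → ℝ) :
    ∫ ω, ((fIn + fOut) x ω - w ⬝ᵥ fun i => (fIn + fOut) (X i) ω + ξ i ω) ^ 2 ∂P =
      meanSqError (ioKernel hNN (θin, θout)) noiseVar X x w := by
  have hh := hM.memLp_target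
  have hξ := hM.memLp_noise
  set y : Fin n → Ω → ℝ := fun i => (fIn + fOut) (X i) + ξ i
  have hy : ∀ i, MemLp (y i) 2 P := fun i => (hh (X i)).add (hξ i)
  have hwy : ∀ i, MemLp (fun ω => w i * y i ω) 2 P := fun i => (hy i).const_mul _
  have hS : MemLp (fun ω => ∑ i, w i * y i ω) 2 P := memLp_finsetSum _ fun i _ => hwy i
  have hZ : MemLp (fun ω => (fIn + fOut) x ω - ∑ i, w i * y i ω) 2 P := hM.memLp_error X x w
  have hy0 : ∀ i, ∫ ω, y i ω ∂P = 0 := fun i => by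
    have := integral_add ((hh (X i)).integrable one_le_two) ((hξ i).integrable one_le_two)
    rw [hM.integral_target, hM.integral_noise, add_zero] at this
    exact this
  -- The error is centred, so its second moment is its variance, which expands bilinearly into
  -- covariances.
  have hmean : ∫ ω, ((fIn + fOut) x ω - ∑ i, w i * y i ω) ∂P = 0 := by
    rw [integral_sub ((hh x).integrable one_le_two) (hS.integrable one_le_two),
      hM.integral_target, integral_finsetSum _ fun i _ => (hwy i).integrable one_le_two]
    simp [integral_const_mul, hy0]
  have hxy : ∀ i, cov[(fIn + fOut) x, y i; P] = ioKernel hNN (θin, θout) x (X i) := fun i => by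
    rw [covariance_add_right (hh x) (hh (X i)) (hξ i), hM.covariance_target,
      hM.covariance_target_noise, add_zero]
  have hyy : ∀ i j, cov[y i, y j; P] = noisyGram (ioKernel hNN (θin, θout)) noiseVar X i j := by
    intro i j
    rw [covariance_add_left (hh (X i)) (hξ i) (hy j),
      covariance_add_right (hh (X i)) (hh (X j)) (hξ j),
      covariance_add_right (hξ i) (hh (X j)) (hξ j), hM.covariance_target,
      hM.covariance_target_noise, covariance_comm (ξ i), hM.covariance_target_noise,
      hM.covariance_noise]
    simp [noisyGram, Matrix.one_apply]
  change ∫ ω, ((fIn + fOut) x ω - ∑ i, w i * y i ω) ^ 2 ∂P = _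
  rw [← variance_of_integral_eq_zero hZ.aemeasurable hmean, ← covariance_self hZ.aemeasurable,
    covariance_fun_sub_fun_sub (hh x) hS (hh x) hS, covariance_comm (fun ω => ∑ i, w i * y i ω),
    covariance_fun_sum_right hwy (hh x), covariance_fun_sum_fun_sum hwy hwy]
  simp_rw [covariance_const_mul_right, covariance_const_mul_left, hxy, hyy]
  rw [hM.covariance_target, meanSqError]
  simp only [dotProduct, Matrix.mulVec, Finset.mul_sum]
  have : ∀ i j, w j * (w i * noisyGram (ioKernel hNN (θin, θout)) noiseVar X i j) =
    w i * (noisyGram (ioKernel hNN (θin, θout)) noiseVar X i j * w j) := fun i j => by ring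
  simp_rw [this]
  rw [← Finset.mul_sum]
  ring

theorem meanSqError_nonneg [IsProbabilityMeasure P] (X : Fin n → EuclideanSpace ℝ (Fin d))
    (x : EuclideanSpace ℝ (Fin d)) (w : Fin n → ℝ) :
    0 ≤ meanSqError (ioKernel hNN (θin, θout)) noiseVar X x w := by
  rw [← hM.integral_sq_error]
  exact integral_nonneg fun ω => sq_nonneg _

theorem lintegral_sq_error [IsProbabilityMeasure P] (X : Fin n → EuclideanSpace ℝ (Fin d))
    (x : EuclideanSpace ℝ (Fin d)) (w : Fin n → ℝ) :
    ∫⁻ ω, ENNReal.ofReal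
        (((fIn + fOut) x ω - w ⬝ᵥ fun i => (fIn + fOut) (X i) ω + ξ i ω) ^ 2) ∂P =
      ENNReal.ofReal (meanSqError (ioKernel hNN (θin, θout)) noiseVar X x w) := by
  rw [← hM.integral_sq_error, ofReal_integral_eq_lintegral_ofReal
    (hM.memLp_error X x w).integrable_sq (Filter.Eventually.of_forall fun ω => sq_nonneg _)]

end IsIOModel

end Model

/-! ### Uniform mismatch of RBF weights -/

section Residual

variable {T V : Type*} [NormedAddCommGroup V] {n : ℕ}

/-- The summed residual of the linear system that determines the weights of a GP learner at `z`.
The learner uses an RBF kernel on the features `φ`, with `a = 1 / (2 l²)`; the system is normalized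
so that `μ = σ² / (σ² + τ)` ranges over a bounded set. -/
noncomputable def normalizedResidual (φ : T → V) (a μ : ℝ) (X : Fin n → T) (z : T)
    (w : Fin n → ℝ) : ℝ :=
  ∑ i, (μ * (∑ j, Real.exp (-a * ‖φ (X i) - φ (X j)‖ ^ 2) * w j -
    Real.exp (-a * ‖φ z - φ (X i)‖ ^ 2)) + (1 - μ) * w i)

/-- Each row of `(K + τ I) w = k` is divided by `σ² + τ`. This places the pair `(σ², τ)` in the
compact range `μ ∈ [0, 1]`. -/
theorem normalizedResidual_eq_zero {φ : T → V} {θ : RBFParams} {τ : ℝ} (hτ : 0 < τ)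
    {X : Fin n → T} {z : T} {w : Fin n → ℝ}
    (hw : noisyGram (fun x x' => rbf θ (φ x) (φ x')) τ X *ᵥ w =
      fun i => rbf θ (φ z) (φ (X i))) :
    normalizedResidual φ (1 / (2 * θ.lengthScale ^ 2)) (θ.signalVar / (θ.signalVar + τ)) X z w =
      0 := by
  have hs := θ.signalVar_pos
  refine Finset.sum_eq_zero fun i _ => ?_
  have h := congrFun hw i
  rw [noisyGram_mulVec_apply] at h
  simp only [rbf, mul_assoc, ← Finset.mul_sum] at h
  have h1 : 1 - θ.signalVar / (θ.signalVar + τ) = τ / (θ.signalVar + τ) := by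
    field_simp
    ring
  rw [h1, div_mul_eq_mul_div, div_mul_eq_mul_div, ← add_div, mul_sub, ← h]
  simp

/-- The exponentials are at most `1`, so each of the `n` rows is a convex combination of two
quantities bounded by `n * δ`. -/
theorem normalizedResidual_sub_le (φ : T → V) {a μ δ : ℝ} (ha : 0 ≤ a) (hμ : μ ∈ Set.Icc (0 : ℝ) 1)
    (X : Fin n → T) (z : T) {w w' : Fin n → ℝ} (hw : ∀ j, |w j - w' j| ≤ δ) :
    |normalizedResidual φ a μ X z w - normalizedResidual φ a μ X z w'| ≤ n * (n * δ) := by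
  have hterm : ∀ i, |μ * ∑ j, Real.exp (-a * ‖φ (X i) - φ (X j)‖ ^ 2) * (w j - w' j) +
      (1 - μ) * (w i - w' i)| ≤ n * δ := by
    intro i
    have hδ : 0 ≤ δ := (abs_nonneg _).trans (hw i)
    have hn : (1 : ℝ) ≤ n := by
      exact_mod_cast (Nat.succ_le_iff.2 i.pos)
    have h1 : |∑ j, Real.exp (-a * ‖φ (X i) - φ (X j)‖ ^ 2) * (w j - w' j)| ≤ n * δ := by
      refine (Finset.abs_sum_le_sum_abs _ _).trans ?_
      have : ∀ j ∈ Finset.univ, |Real.exp (-a * ‖φ (X i) - φ (X j)‖ ^ 2) * (w j - w' j)| ≤ δ := by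
        intro j _
        rw [abs_mul, abs_of_pos (Real.exp_pos _)]
        refine (mul_le_of_le_one_left (abs_nonneg _) ?_).trans (hw j)
        rw [Real.exp_le_one_iff, neg_mul, neg_nonpos]
        positivity
      simpa using Finset.sum_le_card_nsmul _ _ _ this
    calc _ ≤ |μ * ∑ j, Real.exp (-a * ‖φ (X i) - φ (X j)‖ ^ 2) * (w j - w' j)| +
          |(1 - μ) * (w i - w' i)| := abs_add_le _ _
      _ ≤ μ * (n * δ) + (1 - μ) * (n * δ) := by
        rw [abs_mul, abs_mul, abs_of_nonneg hμ.1, abs_of_nonneg (sub_nonneg.2 hμ.2)]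
        refine add_le_add (mul_le_mul_of_nonneg_left h1 hμ.1)
          (mul_le_mul_of_nonneg_left ((hw i).trans ?_) (sub_nonneg.2 hμ.2))
        nlinarith
      _ = n * δ := by ring
  have hsub : normalizedResidual φ a μ X z w - normalizedResidual φ a μ X z w' =
      ∑ i, (μ * ∑ j, Real.exp (-a * ‖φ (X i) - φ (X j)‖ ^ 2) * (w j - w' j) +
        (1 - μ) * (w i - w' i)) := by
    simp only [normalizedResidual, ← Finset.sum_sub_distrib, mul_sub (Real.exp _)]
    refine Finset.sum_congr rfl fun i _ => ?_
    rw [Finset.sum_sub_distrib]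
    ring
  rw [hsub]
  refine (Finset.abs_sum_le_sum_abs _ _).trans ?_
  simpa using Finset.sum_le_card_nsmul Finset.univ _ _ fun i _ => hterm i

/-- All rows coincide here, so summing them loses no information. -/
theorem normalizedResidual_const (φ : T → V) (a μ c : ℝ) (x₀ z : T) :
    normalizedResidual φ a μ (fun _ : Fin n => x₀) z (fun _ => c) =
      n * ((μ * n + (1 - μ)) * c - μ * Real.exp (-a * ‖φ z - φ x₀‖ ^ 2)) := by
  simp [normalizedResidual]
  ring

/-- The diagonal entry `1` and nonnegative weights make each row at least `w i - μ * e`. This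
handles large `a`, where compactness fails. -/
theorem le_normalizedResidual (φ : T → V) {a μ b e : ℝ} (hμ : μ ∈ Set.Icc (0 : ℝ) 1)
    (X : Fin n → T) (z : T) {w : Fin n → ℝ} (hb : 0 ≤ b) (he : 0 ≤ e) (hw : ∀ j, b ≤ w j)
    (hexp : ∀ i, Real.exp (-a * ‖φ z - φ (X i)‖ ^ 2) ≤ e) :
    n * (b - e) ≤ normalizedResidual φ a μ X z w := by
  have hterm : ∀ i ∈ Finset.univ, b - e ≤ μ * (∑ j, Real.exp (-a * ‖φ (X i) - φ (X j)‖ ^ 2) * w j -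
      Real.exp (-a * ‖φ z - φ (X i)‖ ^ 2)) + (1 - μ) * w i := by
    intro i _
    have h1 : w i ≤ ∑ j, Real.exp (-a * ‖φ (X i) - φ (X j)‖ ^ 2) * w j := by
      have := Finset.single_le_sum (f := fun j => Real.exp (-a * ‖φ (X i) - φ (X j)‖ ^ 2) * w j)
        (fun j _ => mul_nonneg (Real.exp_pos _).le (hb.trans (hw j))) (Finset.mem_univ i)
      simpa using this
    have h2 := mul_le_mul_of_nonneg_left (sub_le_sub h1 (hexp i)) hμ.1
    have h3 := hw i
    nlinarith [mul_le_of_le_one_left he hμ.2]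
  simpa [normalizedResidual] using Finset.card_nsmul_le_sum _ _ _ hterm

theorem continuous_normalizedResidual [TopologicalSpace T] {S : Type*} [TopologicalSpace S]
    {φ : T → V} (hφ : Continuous φ) {a μ : S → ℝ} {X : S → Fin n → T} {z : S → T}
    {w : S → Fin n → ℝ} (ha : Continuous a) (hμ : Continuous μ) (hX : Continuous X)
    (hz : Continuous z) (hw : Continuous w) :
    Continuous fun s => normalizedResidual φ (a s) (μ s) (X s) (z s) (w s) := by
  unfold normalizedResidual
  fun_prop

/-- Near coinciding training inputs `x₀`, weights that no RBF learner can produce at the three test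
inputs `x₀`, `x₁`, `x₂` have residuals that are bounded below, uniformly in the hyperparameters. -/
theorem exists_le_normalizedResidual [TopologicalSpace T] (hn : 0 < n) {φ : T → V}
    (hφ : Continuous φ) {W : (Fin n → T) → T → Fin n → ℝ}
    (hW : Continuous fun q : (Fin n → T) × T => W q.1 q.2) {x₀ x₁ x₂ : T} {c : T → ℝ}
    (hc : ∀ z, W (fun _ => x₀) z = fun _ => c z) (hc₂ : 0 < c x₂) (hφ₂ : φ x₂ ≠ φ x₀)
    (hne : ∀ a b : ℝ, 0 ≤ a → c x₀ = b → c x₁ = b * Real.exp (-a * ‖φ x₁ - φ x₀‖ ^ 2) →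
      c x₂ ≠ b * Real.exp (-a * ‖φ x₂ - φ x₀‖ ^ 2)) :
    ∃ η > 0, ∀ᶠ q : (Fin n → T) × T × T × T in nhds (fun _ => x₀, x₀, x₁, x₂),
      ∀ a μ : ℝ, 0 ≤ a → μ ∈ Set.Icc (0 : ℝ) 1 →
        η ≤ |normalizedResidual φ a μ q.1 q.2.1 (W q.1 q.2.1)| +
          |normalizedResidual φ a μ q.1 q.2.2.1 (W q.1 q.2.2.1)| +
          |normalizedResidual φ a μ q.1 q.2.2.2 (W q.1 q.2.2.2)| := by
  set F : ((Fin n → T) × T × T × T) × ℝ × ℝ → ℝ := fun s =>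
    |normalizedResidual φ s.2.1 s.2.2 s.1.1 s.1.2.1 (W s.1.1 s.1.2.1)| +
      |normalizedResidual φ s.2.1 s.2.2 s.1.1 s.1.2.2.1 (W s.1.1 s.1.2.2.1)| +
      |normalizedResidual φ s.2.1 s.2.2 s.1.1 s.1.2.2.2 (W s.1.1 s.1.2.2.2)| with hF
  have hFc : Continuous F := by
    refine ((Continuous.abs ?_).add (Continuous.abs ?_)).add (Continuous.abs ?_) <;>
    · refine continuous_normalizedResidual hφ (by fun_prop) (by fun_prop) (by fun_prop)
        (by fun_prop) (hW.comp (Continuous.prodMk (by fun_prop) (by fun_prop)))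
  set q₀ : (Fin n → T) × T × T × T := (fun _ => x₀, x₀, x₁, x₂) with hq₀
  have hn' : (1 : ℝ) ≤ n := by exact_mod_cast hn
  -- If all three residuals vanish, `c` has the excluded exponential form with `b = μ / (μ n + 1 -
  -- μ)`.
  have hF₀ : ∀ a μ : ℝ, 0 ≤ a → μ ∈ Set.Icc (0 : ℝ) 1 → 0 < F (q₀, a, μ) := by
    intro a μ ha hμ
    by_contra hle
    have h0 : ∀ z, normalizedResidual φ a μ (fun _ => x₀) z (W (fun _ => x₀) z) = 0 →
        c z = μ / (μ * n + (1 - μ)) * Real.exp (-a * ‖φ z - φ x₀‖ ^ 2) := by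
      intro z hz
      rw [hc, normalizedResidual_const] at hz
      have hq : 0 < μ * n + (1 - μ) := by nlinarith [hμ.1, hμ.2]
      have := (mul_eq_zero.1 hz).resolve_left (by positivity)
      rw [div_mul_eq_mul_div, eq_div_iff hq.ne']
      linarith
    have hz : F (q₀, a, μ) = 0 := le_antisymm (not_lt.1 hle) (by positivity)
    rw [hF, hq₀] at hz
    dsimp only at hz
    rw [add_eq_zero_iff_of_nonneg (by positivity) (abs_nonneg _),
      add_eq_zero_iff_of_nonneg (abs_nonneg _) (abs_nonneg _), abs_eq_zero, abs_eq_zero,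
      abs_eq_zero] at hz
    exact hne a _ ha (by simpa using h0 x₀ hz.1.1) (h0 x₁ hz.1.2) (h0 x₂ hz.2)
  set v : ℝ := ‖φ x₂ - φ x₀‖ ^ 2 with hv
  have hv0 : 0 < v := by
    have := norm_pos_iff.2 (sub_ne_zero.2 hφ₂)
    positivity
  -- For `a ≥ C` and squared feature distances above `v / 2`, the bound `exp (-t) ≤ 1 / t` makes the
  -- exponentials at most `c x₂ / 4`, half of the lower bound `c x₂ / 2` for nearby weights.
  set C : ℝ := 4 / c x₂ / (v / 2) with hC
  have hC0 : 0 ≤ C := by positivity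
  have hK : IsCompact (Set.Icc 0 C ×ˢ Set.Icc (0 : ℝ) 1) := isCompact_Icc.prod isCompact_Icc
  obtain ⟨y₀, hy₀, hmin⟩ := hK.exists_isMinOn
    ⟨(0, 0), ⟨⟨le_rfl, hC0⟩, ⟨le_rfl, zero_le_one⟩⟩⟩
    (hFc.comp (Continuous.prodMk_right q₀)).continuousOn
  have hy₀' : 0 < F (q₀, y₀) := hF₀ y₀.1 y₀.2 hy₀.1.1 hy₀.2
  -- Tube lemma: compactness gives one neighbourhood of `q₀` for all `(a, μ)` with `a ≤ C`.
  have hsmall : ∀ᶠ q in nhds q₀, ∀ y ∈ Set.Icc 0 C ×ˢ Set.Icc (0 : ℝ) 1,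
      F (q₀, y₀) / 2 < F (q, y) := by
    refine hK.eventually_forall_of_forall_eventually (P := fun q y => F (q₀, y₀) / 2 < F (q, y))
      fun y hy => ?_
    exact hFc.continuousAt.eventually_const_lt ((half_lt_self hy₀').trans_le (hmin hy))
  have hw : ∀ᶠ q in nhds q₀, ∀ j, c x₂ / 2 < W q.1 q.2.2.2 j := by
    rw [Filter.eventually_all]
    intro j
    have : Continuous fun q : (Fin n → T) × T × T × T => W q.1 q.2.2.2 j :=
      (continuous_apply j).comp (hW.comp (Continuous.prodMk (by fun_prop) (by fun_prop)))
    refine this.continuousAt.eventually_const_lt ?_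
    rw [hq₀]
    simp only [hc]
    linarith
  have hd : ∀ᶠ q in nhds q₀, ∀ i, v / 2 < ‖φ q.2.2.2 - φ (q.1 i)‖ ^ 2 := by
    rw [Filter.eventually_all]
    intro i
    have : Continuous fun q : (Fin n → T) × T × T × T => ‖φ q.2.2.2 - φ (q.1 i)‖ ^ 2 := by
      fun_prop
    exact this.continuousAt.eventually_const_lt (half_lt_self hv0)
  refine ⟨min (F (q₀, y₀) / 2) (c x₂ / 4), by positivity, ?_⟩
  filter_upwards [hsmall, hw, hd] with q hs hwq hdq a μ ha hμ
  rcases le_total a C with haC | haC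
  · exact (min_le_left _ _).trans (hs (a, μ) ⟨⟨ha, haC⟩, hμ⟩).le
  · have hexp : ∀ i, Real.exp (-a * ‖φ q.2.2.2 - φ (q.1 i)‖ ^ 2) ≤ c x₂ / 4 := by
      intro i
      have h1 : 4 / c x₂ ≤ a * ‖φ q.2.2.2 - φ (q.1 i)‖ ^ 2 := by
        calc 4 / c x₂ = C * (v / 2) := by rw [hC]; field_simp
          _ ≤ _ := mul_le_mul haC (hdq i).le (by positivity) ha
      calc Real.exp (-a * ‖φ q.2.2.2 - φ (q.1 i)‖ ^ 2) ≤ Real.exp (-(4 / c x₂)) := by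
            rw [neg_mul]
            exact Real.exp_le_exp.2 (neg_le_neg h1)
        _ ≤ (4 / c x₂)⁻¹ := by
            rw [Real.exp_neg]
            exact inv_anti₀ (by positivity) ((le_add_of_nonneg_right zero_le_one).trans
              (Real.add_one_le_exp _))
        _ = c x₂ / 4 := inv_div _ _
    have h2 := le_normalizedResidual φ hμ q.1 q.2.2.2 (half_pos hc₂).le (by positivity)
      (fun j => (hwq j).le) hexp
    have h3 : c x₂ / 4 ≤ |normalizedResidual φ a μ q.1 q.2.2.2 (W q.1 q.2.2.2)| := by
      refine le_trans ?_ (h2.trans (le_abs_self _))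
      nlinarith
    refine (min_le_right _ _).trans (h3.trans (le_add_of_nonneg_left (by positivity)))

end Residual

/-! ### Log-convexity of sums of exponentials -/

section ExpSum

/-- By log-convexity, `s₁ exp (-r) + s₂ exp (-β u)` cannot agree at two points `0 ≤ u < v` with the
multiple of an exponential that has the value `s₁ + s₂` at zero. -/
theorem exp_sum_ne_exp {s₁ s₂ r β u v a : ℝ} (hs₁ : 0 < s₁) (hs₂ : 0 < s₂) (hr : 0 < r)
    (hu : 0 ≤ u) (huv : u < v)
    (h₁ : s₁ * Real.exp (-r) + s₂ * Real.exp (-β * u) = (s₁ + s₂) * Real.exp (-a * u)) :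
    s₁ * Real.exp (-r) + s₂ * Real.exp (-β * v) ≠ (s₁ + s₂) * Real.exp (-a * v) := by
  intro h₂
  have hv : 0 < v := hu.trans_lt huv
  have hs : 0 < s₁ + s₂ := add_pos hs₁ hs₂
  set l := u / v
  have hl0 : 0 ≤ l := by positivity
  have hl1 : l < 1 := (div_lt_one hv).2 huv
  have hlv : v * l = u := by simp only [l]; field_simp
  have hpow : ∀ y : ℝ, Real.exp (-y * v) ^ l = Real.exp (-y * u) := fun y => by
    rw [← Real.exp_mul, mul_assoc, hlv]
  -- Jensen for the concave map `t ↦ t ^ l`, which turns values at `v` into values at `u`. It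
  -- contradicts `h₁` because `exp (-r) < exp (-r * l)`.
  have hconc := (Real.concaveOn_rpow hl0 hl1.le).2 (Set.mem_Ici.2 (Real.exp_pos (-r)).le)
    (Set.mem_Ici.2 (Real.exp_pos (-β * v)).le) (show 0 ≤ s₁ / (s₁ + s₂) by positivity)
    (show 0 ≤ s₂ / (s₁ + s₂) by positivity) (by field_simp)
  have hcomb : s₁ / (s₁ + s₂) * Real.exp (-r) + s₂ / (s₁ + s₂) * Real.exp (-β * v) =
      Real.exp (-a * v) := by
    rw [div_mul_eq_mul_div, div_mul_eq_mul_div, ← add_div, h₂, mul_div_cancel_left₀ _ hs.ne']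
  simp only [smul_eq_mul] at hconc
  rw [hcomb, hpow, hpow, ← Real.exp_mul] at hconc
  have hlt : Real.exp (-r) < Real.exp (-r * l) := Real.exp_lt_exp.2 (by nlinarith)
  have h3 := mul_le_mul_of_nonneg_left hconc hs.le
  rw [← h₁, mul_add, ← mul_assoc, ← mul_assoc, mul_div_cancel₀ _ hs.ne',
    mul_div_cancel₀ _ hs.ne'] at h3
  nlinarith

end ExpSum

/-- A pointwise inequality between functions of i.i.d. inputs, with a gap near some configuration of
coinciding inputs in the support, gives a strict inequality between the averages. -/
theorem lintegral_pi_lt_of_gap {T : Type*} [TopologicalSpace T] [MeasurableSpace T]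
    [OpensMeasurableSpace T] {p : Measure T} [IsProbabilityMeasure p] {n : ℕ} {x₀ : T}
    (hx₀ : x₀ ∈ p.support) {f g : (Fin n → T) → ℝ≥0∞} (hle : ∀ X, f X ≤ g X) {ε : ℝ≥0∞}
    (hε : 0 < ε) (hgap : ∀ᶠ X in nhds fun _ => x₀, f X + ε ≤ g X)
    (hfin : ∫⁻ X, f X ∂(Measure.pi fun _ : Fin n => p) ≠ ∞) :
    ∫⁻ X, f X ∂(Measure.pi fun _ : Fin n => p) < ∫⁻ X, g X ∂(Measure.pi fun _ : Fin n => p) := by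
  obtain ⟨S, hS, hSo, hxS⟩ := mem_nhds_iff.1 hgap
  obtain ⟨U, hU, hUS⟩ := isOpen_pi_iff'.1 hSo _ hxS
  have hUm : MeasurableSet (Set.univ.pi U) :=
    MeasurableSet.univ_pi fun i => (hU i).1.measurableSet
  have hpos : 0 < Measure.pi (fun _ : Fin n => p) (Set.univ.pi U) := by
    rw [Measure.pi_pi, pos_iff_ne_zero, Finset.prod_ne_zero_iff]
    exact fun i _ => ((Measure.mem_support_iff_forall _).1 hx₀ _ ((hU i).1.mem_nhds (hU i).2)).ne'
  calc ∫⁻ X, f X ∂(Measure.pi fun _ : Fin n => p)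
      < ∫⁻ X, f X ∂(Measure.pi fun _ : Fin n => p) +
          ε * Measure.pi (fun _ : Fin n => p) (Set.univ.pi U) :=
        ENNReal.lt_add_right hfin (ENNReal.mul_pos hε.ne' hpos.ne').ne'
    -- Only the indicator has to be measurable; `f` and `g`, possibly infima over uncountable
    -- families, need not be.
    _ = ∫⁻ X, (f X + (Set.univ.pi U).indicator (fun _ => ε) X) ∂(Measure.pi fun _ : Fin n => p) := by
        rw [lintegral_add_right _ (measurable_const.indicator hUm), lintegral_indicator_const hUm]
    _ ≤ ∫⁻ X, g X ∂(Measure.pi fun _ : Fin n => p) := by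
        refine lintegral_mono fun X => ?_
        by_cases hX : X ∈ Set.univ.pi U
        · rw [Set.indicator_of_mem hX]
          exact hS (hUS hX)
        · simpa only [Set.indicator_of_notMem hX, add_zero] using hle X

/-! ### Excess generalization error of a mismatched learner -/

section Gap

variable {Ω T : Type*} [MeasurableSpace Ω] [MeasurableSpace T] {P : Measure Ω} {p : Measure T}
  {n : ℕ} {h : T → Ω → ℝ} {ξ : Fin n → Ω → ℝ} {k : T → T → ℝ} {τ₀ : ℝ}

theorem genError_eq
    (herr : ∀ (X : Fin n → T) x w,
      ∫⁻ ω, ENNReal.ofReal ((h x ω - w ⬝ᵥ fun i => h (X i) ω + ξ i ω) ^ 2) ∂P =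
        ENNReal.ofReal (meanSqError k τ₀ X x w))
    {k' : T → T → ℝ} (hk' : IsPosSemidefKernel k') {τ : ℝ} (hτ : 0 < τ) (X : Fin n → T) :
    genError P p h ξ k' τ X =
      ∫⁻ x, ENNReal.ofReal (meanSqError k τ₀ X x (gpWeights k' τ X x)) ∂p := by
  simp_rw [genError, gpPredictor_eq_gpWeights hk' hτ, herr]

/-- The GP predictor with the true kernel and the true noise variance is optimal. -/
theorem genError_true_le (hk : IsPosSemidefKernel k) (hτ₀ : 0 < τ₀)
    (herr : ∀ (X : Fin n → T) x w,
      ∫⁻ ω, ENNReal.ofReal ((h x ω - w ⬝ᵥ fun i => h (X i) ω + ξ i ω) ^ 2) ∂P =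
        ENNReal.ofReal (meanSqError k τ₀ X x w))
    {k' : T → T → ℝ} (hk' : IsPosSemidefKernel k') {τ : ℝ} (hτ : 0 < τ) (X : Fin n → T) :
    genError P p h ξ k τ₀ X ≤ genError P p h ξ k' τ X := by
  rw [genError_eq herr hk hτ₀, genError_eq herr hk' hτ]
  exact lintegral_mono fun x => ENNReal.ofReal_le_ofReal (meanSqError_gpWeights_le hk hτ₀ X x _)

/-- Comparison with the zero predictor; it provides the finiteness needed for a strict inequality of
averages. -/
theorem genError_true_le_lintegral (hk : IsPosSemidefKernel k) (hτ₀ : 0 < τ₀)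
    (herr : ∀ (X : Fin n → T) x w,
      ∫⁻ ω, ENNReal.ofReal ((h x ω - w ⬝ᵥ fun i => h (X i) ω + ξ i ω) ^ 2) ∂P =
        ENNReal.ofReal (meanSqError k τ₀ X x w))
    (X : Fin n → T) : genError P p h ξ k τ₀ X ≤ ∫⁻ x, ENNReal.ofReal (k x x) ∂p := by
  rw [genError_eq herr hk hτ₀]
  refine lintegral_mono fun x => ENNReal.ofReal_le_ofReal ?_
  simpa [meanSqError] using meanSqError_gpWeights_le hk hτ₀ X x 0

variable [TopologicalSpace T] [OpensMeasurableSpace T]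

theorem add_measure_le_lintegral {f g : T → ℝ≥0∞} {B : Set T} (hB : IsOpen B) {ε : ℝ≥0∞}
    (hle : ∀ x, f x ≤ g x) (hgap : ∀ x ∈ B, f x + ε ≤ g x) :
    ∫⁻ x, f x ∂p + ε * p B ≤ ∫⁻ x, g x ∂p := by
  rw [← lintegral_indicator_const hB.measurableSet,
    ← lintegral_add_right _ (measurable_const.indicator hB.measurableSet)]
  refine lintegral_mono fun x => ?_
  by_cases hx : x ∈ B
  · simpa [hx] using hgap x hx
  · simpa [hx] using hle x

/-- If the weights of the true GP at coinciding training inputs `x₀` cannot be matched by an RBF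
learner on the features `φ` at the test inputs `x₀`, `x₁`, `x₂`, then near this configuration the
excess error of that learner is bounded below, uniformly in its hyperparameters. -/
theorem exists_genError_gap {m : ℕ} (hn : 0 < n) (hk : IsPosSemidefKernel k)
    (hkpos : ∀ x x', 0 < k x x') (hkcont : Continuous fun q : T × T => k q.1 q.2) (hτ₀ : 0 < τ₀)
    (herr : ∀ (X : Fin n → T) x w,
      ∫⁻ ω, ENNReal.ofReal ((h x ω - w ⬝ᵥ fun i => h (X i) ω + ξ i ω) ^ 2) ∂P =
        ENNReal.ofReal (meanSqError k τ₀ X x w))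
    (hnonneg : ∀ (X : Fin n → T) x w, 0 ≤ meanSqError k τ₀ X x w)
    {φ : T → EuclideanSpace ℝ (Fin m)} (hφ : Continuous φ) {x₀ x₁ x₂ : T} (h₀ : x₀ ∈ p.support)
    (h₁ : x₁ ∈ p.support) (h₂ : x₂ ∈ p.support) (hφ₂ : φ x₂ ≠ φ x₀)
    (hne : ∀ a : ℝ, 0 ≤ a → k x₁ x₀ = k x₀ x₀ * Real.exp (-a * ‖φ x₁ - φ x₀‖ ^ 2) →
      k x₂ x₀ ≠ k x₀ x₀ * Real.exp (-a * ‖φ x₂ - φ x₀‖ ^ 2)) :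
    ∃ ε > 0, ∀ᶠ X : Fin n → T in nhds fun _ => x₀, ∀ (θ : RBFParams) (τ : ℝ), 0 < τ →
      genError P p h ξ k τ₀ X + ε ≤
        genError P p h ξ (fun x x' => rbf θ (φ x) (φ x')) τ X := by
  have hN : 0 < n * k x₀ x₀ + τ₀ := by
    have := hkpos x₀ x₀
    positivity
  obtain ⟨η, hη, hev⟩ := exists_le_normalizedResidual hn hφ (continuous_gpWeights hk hτ₀ hkcont)
    (x₁ := x₁) (c := fun z => k z x₀ / (n * k x₀ x₀ + τ₀))
    (fun z => gpWeights_const hk hτ₀ x₀ z hN.ne') (div_pos (hkpos _ _) hN) hφ₂ (by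
      rintro a _ ha rfl e1 e2
      rw [div_mul_eq_mul_div, div_left_inj' hN.ne'] at e1 e2
      exact hne a ha e1 e2)
  -- The neighbourhood is split into a product: `U` for the training inputs and `B₀`, `B₁`, `B₂` for
  -- the test points.
  obtain ⟨U, V, hU, hxU, hV, hxV, hUV⟩ := mem_nhds_prod_iff'.1 hev
  obtain ⟨B₀, V', hB₀, hx₀, hV', hxV', hBV⟩ := mem_nhds_prod_iff'.1 (hV.mem_nhds hxV)
  obtain ⟨B₁, B₂, hB₁, hx₁, hB₂, hx₂, hBB⟩ := mem_nhds_prod_iff'.1 (hV'.mem_nhds hxV')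
  have hn' : (1 : ℝ) ≤ n := by exact_mod_cast hn
  -- Weights within `δ` of the true ones give residuals at most `η / 4`; three of these sum to less
  -- than `η`.
  set δ : ℝ := η / (4 * (n * n)) with hδdef
  have hδ : 0 < δ := by positivity
  set ε : ℝ≥0∞ := ENNReal.ofReal (τ₀ * δ ^ 2) with hεdef
  have hpB : ∀ {x : T} {B : Set T}, x ∈ p.support → IsOpen B → x ∈ B → 0 < p B :=
    fun hx hB hxB => (Measure.mem_support_iff_forall _).1 hx _ (hB.mem_nhds hxB)
  refine ⟨ε * min (p B₀) (min (p B₁) (p B₂)), ENNReal.mul_pos (by simp [hεdef]; positivity) ?_, ?_⟩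
  · exact (lt_min (hpB h₀ hB₀ hx₀) (lt_min (hpB h₁ hB₁ hx₁) (hpB h₂ hB₂ hx₂))).ne'
  filter_upwards [hU.mem_nhds hxU] with X hX θ τ hτ
  have hk' := isPosSemidefKernel_rbf_comp φ θ
  rw [genError_eq herr hk hτ₀, genError_eq herr hk' hτ]
  set w : T → Fin n → ℝ := gpWeights (fun x x' => rbf θ (φ x) (φ x')) τ X
  have hs := θ.signalVar_pos
  have hl := θ.lengthScale_pos
  set a := 1 / (2 * θ.lengthScale ^ 2) with ha
  set μ := θ.signalVar / (θ.signalVar + τ) with hμdef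
  have ha0 : 0 ≤ a := by positivity
  have hμ : μ ∈ Set.Icc (0 : ℝ) 1 :=
    ⟨by positivity, (div_le_one (by positivity)).2 (by linarith)⟩
  have hres : ∀ z, (∀ j, |w z j - gpWeights k τ₀ X z j| ≤ δ) →
      |normalizedResidual φ a μ X z (gpWeights k τ₀ X z)| ≤ η / 4 := by
    intro z hz
    have e1 := normalizedResidual_sub_le φ ha0 hμ X z hz
    rw [normalizedResidual_eq_zero hτ (noisyGram_mulVec_gpWeights hk' hτ X z), zero_sub,
      abs_neg] at e1
    refine e1.trans_eq ?_
    rw [hδdef]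
    field_simp
  have hsome : ∀ z₀ ∈ B₀, ∀ z₁ ∈ B₁, ∀ z₂ ∈ B₂,
      (∃ j, δ < |w z₀ j - gpWeights k τ₀ X z₀ j|) ∨ (∃ j, δ < |w z₁ j - gpWeights k τ₀ X z₁ j|) ∨
        ∃ j, δ < |w z₂ j - gpWeights k τ₀ X z₂ j| := by
    intro z₀ hz₀ z₁ hz₁ z₂ hz₂
    by_contra! hcon
    have := hUV (Set.mk_mem_prod hX (hBV (Set.mk_mem_prod hz₀ (hBB (Set.mk_mem_prod hz₁ hz₂)))))
      a μ ha0 hμ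
    linarith [hres z₀ hcon.1, hres z₁ hcon.2.1, hres z₂ hcon.2.2]
  have hmono : ∀ z, ENNReal.ofReal (meanSqError k τ₀ X z (gpWeights k τ₀ X z)) ≤
      ENNReal.ofReal (meanSqError k τ₀ X z (w z)) := fun z =>
    ENNReal.ofReal_le_ofReal (meanSqError_gpWeights_le hk hτ₀ X z _)
  have hgap : ∀ z, (∃ j, δ < |w z j - gpWeights k τ₀ X z j|) →
      ENNReal.ofReal (meanSqError k τ₀ X z (gpWeights k τ₀ X z)) + ε ≤
        ENNReal.ofReal (meanSqError k τ₀ X z (w z)) := by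
    rintro z ⟨j, hj⟩
    rw [hεdef, ← ENNReal.ofReal_add (hnonneg _ _ _) (by positivity)]
    refine ENNReal.ofReal_le_ofReal (le_trans ?_ (meanSqError_gpWeights_add_le hk hτ₀ X z (w z)))
    gcongr
    calc δ ^ 2 ≤ (w z j - gpWeights k τ₀ X z j) * (w z j - gpWeights k τ₀ X z j) := by
          rw [← sq, ← sq_abs (w z j - _)]
          gcongr
      _ ≤ _ := Finset.single_le_sum
          (f := fun j => (w z j - gpWeights k τ₀ X z j) * (w z j - gpWeights k τ₀ X z j))
          (fun j _ => mul_self_nonneg _) (Finset.mem_univ j)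
  have hfinish : ∀ B : Set T, IsOpen B → min (p B₀) (min (p B₁) (p B₂)) ≤ p B →
      (∀ z ∈ B, ∃ j, δ < |w z j - gpWeights k τ₀ X z j|) →
      ∫⁻ x, ENNReal.ofReal (meanSqError k τ₀ X x (gpWeights k τ₀ X x)) ∂p +
          ε * min (p B₀) (min (p B₁) (p B₂)) ≤
        ∫⁻ x, ENNReal.ofReal (meanSqError k τ₀ X x (w x)) ∂p := fun B hB hpB hall =>
    (add_le_add le_rfl (mul_le_mul_right hpB ε)).trans
      (add_measure_le_lintegral hB hmono fun z hz => hgap z (hall z hz))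
  -- One of the three sets consists entirely of bad test points: if `B₀` and `B₁` both contain a
  -- good one, `hsome` makes every point of `B₂` bad. Which set it is may depend on `X`, `θ` and
  -- `τ`, hence the minimum of the measures.
  by_cases c₀ : ∀ z ∈ B₀, ∃ j, δ < |w z j - gpWeights k τ₀ X z j|
  · exact hfinish B₀ hB₀ (min_le_left _ _) c₀
  by_cases c₁ : ∀ z ∈ B₁, ∃ j, δ < |w z j - gpWeights k τ₀ X z j|
  · exact hfinish B₁ hB₁ ((min_le_right _ _).trans (min_le_left _ _)) c₁
  · push Not at c₀ c₁
    obtain ⟨z₀, hz₀, hw₀⟩ := c₀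
    obtain ⟨z₁, hz₁, hw₁⟩ := c₁
    refine hfinish B₂ hB₂ ((min_le_right _ _).trans (min_le_right _ _)) fun z₂ hz₂ => ?_
    rcases hsome z₀ hz₀ z₁ hz₁ z₂ hz₂ with ⟨j, hj⟩ | ⟨j, hj⟩ | hj
    · exact absurd hj (not_lt.2 (hw₀ j))
    · exact absurd hj (not_lt.2 (hw₁ j))
    · exact hj

end Gap

/-! ### The I/O kernel is not matched by a single RBF kernel -/

section IOKernelNe

variable {d m : ℕ} {hNN : EuclideanSpace ℝ (Fin d) → EuclideanSpace ℝ (Fin m)}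

theorem rbf_eq_rbf_iff {V : Type*} [NormedAddCommGroup V] (θ : RBFParams) {u v u' v' : V} :
    rbf θ u v = rbf θ u' v' ↔ ‖u - v‖ = ‖u' - v'‖ := by
  have hl := θ.lengthScale_pos
  have hc : -(1 / (2 * θ.lengthScale ^ 2)) ≠ 0 := neg_ne_zero.2 (by positivity)
  rw [rbf, rbf, mul_right_inj' θ.signalVar_pos.ne', Real.exp_eq_exp, mul_right_inj' hc,
    sq_eq_sq₀ (norm_nonneg _) (norm_nonneg _)]

theorem ioKernel_ne_of_input_eq (θ : RBFParams × RBFParams) {x₀ x₁ x₂ : EuclideanSpace ℝ (Fin d)}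
    (heq : ‖x₁ - x₀‖ = ‖x₂ - x₀‖) (hne : ‖hNN x₁ - hNN x₀‖ ≠ ‖hNN x₂ - hNN x₀‖) :
    ioKernel hNN θ x₁ x₀ ≠ ioKernel hNN θ x₂ x₀ := by
  intro h
  rw [ioKernel, ioKernel, inKernel, inKernel, (rbf_eq_rbf_iff θ.1).2 heq, add_right_inj] at h
  exact hne ((rbf_eq_rbf_iff θ.2).1 h)

/-- Equal input distances make the input part the same constant `s₁ exp (-r)` at `x₁` and `x₂`, so
`exp_sum_ne_exp` applies to the squared output distances. -/
theorem ioKernel_ne_exp_output (θ : RBFParams × RBFParams) {x₀ x₁ x₂ : EuclideanSpace ℝ (Fin d)}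
    (heq : ‖x₁ - x₀‖ = ‖x₂ - x₀‖) (hlt : ‖hNN x₁ - hNN x₀‖ < ‖hNN x₂ - hNN x₀‖) {a : ℝ}
    (h₁ : ioKernel hNN θ x₁ x₀ =
      ioKernel hNN θ x₀ x₀ * Real.exp (-a * ‖hNN x₁ - hNN x₀‖ ^ 2)) :
    ioKernel hNN θ x₂ x₀ ≠ ioKernel hNN θ x₀ x₀ * Real.exp (-a * ‖hNN x₂ - hNN x₀‖ ^ 2) := by
  have hr : 0 < ‖x₂ - x₀‖ := by
    rw [norm_pos_iff, sub_ne_zero]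
    rintro rfl
    rw [sub_self, norm_zero, norm_eq_zero, sub_eq_zero] at heq
    rw [heq] at hlt
    exact lt_irrefl _ hlt
  have hl := θ.1.lengthScale_pos
  simp only [ioKernel, inKernel, outKernel, rbf_self] at h₁ ⊢
  simp only [rbf, heq] at h₁ ⊢
  rw [neg_mul (1 / (2 * θ.1.lengthScale ^ 2))] at h₁ ⊢
  exact exp_sum_ne_exp θ.1.signalVar_pos θ.2.signalVar_pos (by positivity) (by positivity)
    (by gcongr) h₁

end IOKernelNe

end IOKernel

/-! ### The main theorem -/

theorem theorem3 {Ω : Type*} [MeasurableSpace Ω] (P : Measure Ω) [IsProbabilityMeasure P]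
    {d m n : ℕ} (hn : 0 < n)
    (p : Measure (EuclideanSpace ℝ (Fin d))) [IsProbabilityMeasure p]
    (hNN : EuclideanSpace ℝ (Fin d) → EuclideanSpace ℝ (Fin m)) (hNN_cont : Continuous hNN)
    (ν : Measure
      (EuclideanSpace ℝ (Fin d) × EuclideanSpace ℝ (Fin d) × EuclideanSpace ℝ (Fin d)))
    (hν : ∀ᵐ t ∂ν, t.1 ∈ p.support ∧ t.2.1 ∈ p.support ∧ t.2.2 ∈ p.support)
    (hNN_nonaffine : IOKernel.NontriviallyNonAffine hNN ν)
    (θin θout : IOKernel.RBFParams) (noiseVar : ℝ≥0) (hnoise : 0 < noiseVar)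
    (fIn fOut : EuclideanSpace ℝ (Fin d) → Ω → ℝ) (ξ : Fin n → Ω → ℝ)
    (hmodel : IOKernel.IsIOModel P hNN θin θout noiseVar fIn fOut ξ) :
    -- for all training inputs the correct hyperparameters are optimal for the I/O kernel, and the
    -- error with the I/O kernel does not exceed the errors with a single kernel
    (∀ X : Fin n → EuclideanSpace ℝ (Fin d),
      IOKernel.optGenError P p (fIn + fOut) ξ (IOKernel.ioKernel hNN) X =
          IOKernel.genError P p (fIn + fOut) ξ (IOKernel.ioKernel hNN (θin, θout)) noiseVar X ∧
        IOKernel.optGenError P p (fIn + fOut) ξ (IOKernel.ioKernel hNN) X ≤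
          IOKernel.optGenError P p (fIn + fOut) ξ IOKernel.inKernel X ∧
        IOKernel.optGenError P p (fIn + fOut) ξ (IOKernel.ioKernel hNN) X ≤
          IOKernel.optGenError P p (fIn + fOut) ξ (IOKernel.outKernel hNN) X) ∧
    -- the error with the I/O kernel is strictly smaller than the error with the input kernel
    IOKernel.expGenError P p (fIn + fOut) ξ (IOKernel.ioKernel hNN) <
        IOKernel.expGenError P p (fIn + fOut) ξ IOKernel.inKernel ∧
    -- and strictly smaller than the error with the output kernel
    IOKernel.expGenError P p (fIn + fOut) ξ (IOKernel.ioKernel hNN) <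
        IOKernel.expGenError P p (fIn + fOut) ξ (IOKernel.outKernel hNN) := by
  have hτ₀ : (0 : ℝ) < noiseVar := NNReal.coe_pos.2 hnoise
  set k := IOKernel.ioKernel hNN (θin, θout) with hkdef
  have hk : IOKernel.IsPosSemidefKernel k := IOKernel.isPosSemidefKernel_ioKernel hNN _
  have hkpos := IOKernel.ioKernel_pos hNN (θin, θout)
  have hkcont := IOKernel.continuous_ioKernel hNN_cont (θin, θout)
  have herr := hmodel.lintegral_sq_error
  have hnonneg := hmodel.meanSqError_nonneg
  have hle : ∀ {Θ : Type} {k' : Θ → EuclideanSpace ℝ (Fin d) → EuclideanSpace ℝ (Fin d) → ℝ},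
      (∀ θ, IOKernel.IsPosSemidefKernel (k' θ)) → ∀ X,
      IOKernel.genError P p (fIn + fOut) ξ k noiseVar X ≤
        IOKernel.optGenError P p (fIn + fOut) ξ k' X := fun hk' X =>
    le_iInf fun θ => le_iInf fun τ => IOKernel.genError_true_le hk hτ₀ herr (hk' θ) τ.2 X
  have hIn : ∀ θ, IOKernel.IsPosSemidefKernel (IOKernel.inKernel (d := d) θ) :=
    IOKernel.isPosSemidefKernel_rbf_comp id
  have hOut : ∀ θ, IOKernel.IsPosSemidefKernel (IOKernel.outKernel hNN θ) :=
    IOKernel.isPosSemidefKernel_rbf_comp hNN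
  have hopt : ∀ X, IOKernel.optGenError P p (fIn + fOut) ξ (IOKernel.ioKernel hNN) X =
      IOKernel.genError P p (fIn + fOut) ξ k noiseVar X := fun X =>
    le_antisymm (iInf_le_of_le (θin, θout) (iInf_le_of_le ⟨noiseVar, hτ₀⟩ le_rfl))
      (hle (IOKernel.isPosSemidefKernel_ioKernel hNN) X)
  have hfin : ∫⁻ X, IOKernel.genError P p (fIn + fOut) ξ k noiseVar X
      ∂(Measure.pi fun _ : Fin n => p) ≠ ∞ := by
    refine ((lintegral_mono fun X => IOKernel.genError_true_le_lintegral hk hτ₀ herr X).trans_lt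
      ?_).ne
    simp [hkdef, IOKernel.ioKernel, IOKernel.inKernel, IOKernel.outKernel, IOKernel.rbf_self]
  obtain ⟨⟨x₀, x₁, x₂⟩, ⟨heq, hne⟩, h₀, h₁, h₂⟩ :
      ∃ t ∈ IOKernel.nonAffineTriples hNN,
        t.1 ∈ p.support ∧ t.2.1 ∈ p.support ∧ t.2.2 ∈ p.support := by
    by_contra! hcon
    refine hNN_nonaffine.ne' (measure_mono_null (fun t ht => ?_) (ae_iff.1 hν))
    exact fun hs => hcon t ht hs.1 hs.2.1 hs.2.2
  simp only at heq hne h₀ h₁ h₂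
  rw [norm_sub_rev x₀ x₁, norm_sub_rev x₀ x₂] at heq
  rw [norm_sub_rev (hNN x₀), norm_sub_rev (hNN x₀)] at hne
  -- The hypotheses are symmetric in `x₁` and `x₂`. Taking `x₂` as the farther point in output space
  -- also gives `x₂ ≠ x₀` under both feature maps.
  wlog hlt : ‖hNN x₁ - hNN x₀‖ < ‖hNN x₂ - hNN x₀‖ generalizing x₁ x₂
  · exact this x₂ x₁ heq.symm hne.symm h₂ h₁ (lt_of_le_of_ne (not_lt.1 hlt) hne.symm)
  have hφ₂ : hNN x₂ ≠ hNN x₀ := fun h => by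
    rw [h, sub_self, norm_zero] at hlt
    exact absurd hlt (norm_nonneg _).not_gt
  refine ⟨fun X => ⟨hopt X, (hopt X).trans_le (hle hIn X), (hopt X).trans_le (hle hOut X)⟩, ?_, ?_⟩
  · obtain ⟨ε, hε, hgap⟩ := IOKernel.exists_genError_gap (φ := id) hn hk hkpos hkcont hτ₀ herr
      hnonneg continuous_id h₀ h₁ h₂ (fun h => hφ₂ (congrArg hNN h)) (by
        intro a _ e1 e2
        refine IOKernel.ioKernel_ne_of_input_eq (θin, θout) heq hne ?_
        rw [← hkdef, e1, e2, id, id, id, heq])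
    simp_rw [IOKernel.expGenError, hopt]
    exact IOKernel.lintegral_pi_lt_of_gap h₀ (hle hIn) hε
      (hgap.mono fun X hX => le_iInf fun θ => le_iInf fun τ => hX θ τ τ.2) hfin
  · obtain ⟨ε, hε, hgap⟩ := IOKernel.exists_genError_gap (φ := hNN) hn hk hkpos hkcont hτ₀ herr
      hnonneg hNN_cont h₀ h₁ h₂ hφ₂
      (fun a _ e1 => IOKernel.ioKernel_ne_exp_output (θin, θout) heq hlt e1)
    simp_rw [IOKernel.expGenError, hopt]
    exact IOKernel.lintegral_pi_lt_of_gap h₀ (hle hOut) hε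
      (hgap.mono fun X hX => le_iInf fun θ => le_iInf fun τ => hX θ τ τ.2) hfin
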